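/- An MT-algebra is a complete boolean algebra $M$ with an operator $\square$ satisfying $\square 1=1$, $\square(a\wedge b)=\square a\wedge\square b$, $\square a\le a$ and $\square a\le\square\square a$; put $\diamond a=\neg\square\neg a$. An MT-morphism is a map $f:M\to N$ preserving arbitrary joins and meets and complements with $f(\square a)\le\square f(a)$. An element $a$ is open if $a=\square a$, closed if $a=\diamond a$, clopen if it is both, saturated if it is a meet of open elements, and compact if every cover of $a$ by open elements (a set $S$ of open elements with $a\le\bigvee S$) has a finite subcover. Let $\mathcal O(M)$ be the frame of open elements of $M$. $M$ is *zero-dimensional* if every element is a join of closed elements and every open element is a join of clopen elements; *locally compact* if every open $u$ is the join of the open elements $v$ for which there is a compact $k$ with $v\le k\le u$; *Hausdorff* if every element is a join of elements $b$ with $b=\bigwedge\{\diamond\square c\mid b\le\square c\}$; *compact* if $1$ is compact. $M$ is *locally Stone* if it is zero-dimensional, locally compact and Hausdorff. An MT-morphism is *proper* if it sends compact saturated elements to compact saturated elements. A frame $L$ is *locally Stone* if every element $a$ is the join of the elements way below $a$, and every element is a join of complemented elements. A frame homomorphism is *proper* if it preserves the way-below relation $\ll$. A topological space is *locally Stone*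 if it is locally compact, Hausdorff, and zero-dimensional ($T_1$ with a basis of clopen sets). A continuous map is *proper* if preimages of compact saturated sets are compact. Let $\mathbf{LStoneMT}$, $\mathbf{LStoneFrm}$, $\mathbf{LStone}$ be the categories of locally Stone MT-algebras, frames and spaces with proper MT-morphisms, proper frame homomorphisms and proper continuous maps, respectively, and let $\mathbf{StoneMT}$, $\mathbf{StoneFrm}$, $\mathbf{Stone}$ be their full subcategories of compact objects. Let $\mathcal O$ be the functor from MT-algebras to frames that restricts MT-morphisms to open elements. Let $\mathcal P$ be the contravariant functor sending a space $X$ to its powerset with the interior operator and a continuous map to its preimage map. Let $\mathrm{at}$ be the contravariant functor sending an MT-algebra $M$ to its set of atoms, with open sets $\eta(u)=\{x \mid x\le u\}$ for $u\in\mathcal O(M)$, and an MT-morphism $f$ to the restriction of its left adjoint $f^*(x)=\bigwedge\{a\mid x\le f(a)\}$. Then: 1. $\mathcal O$ restricts to an equivalence $\mathbf{LStoneMT}\to\mathbf{LStoneFrm}$. 2. $\mathrm{at}$ and $\mathcal P$ restrict to a dual equivalence between $\mathbf{LStoneMT}$ and $\mathbf{LStone}$, with natural isomorphisms $\eta:M\to\mathcal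 P(\mathrm{at}(M))$, $\eta(a)=\{x\mid x\le a\}$, and $\varepsilon:X\to\mathrm{at}(\mathcal P(X))$, $\varepsilon(x)=\{x\}$. 3. $\mathcal O$ restricts to an equivalence $\mathbf{StoneMT}\to\mathbf{StoneFrm}$, and $\mathrm{at}$ and $\mathcal P$ restrict to a dual equivalence between $\mathbf{StoneMT}$ and $\mathbf{Stone}$, with the same natural isomorphisms. Moreover every MT-morphism between Stone MT-algebras, every frame homomorphism between Stone frames and every continuous map between Stone spaces is proper, so these three categories are full subcategories of the categories of MT-algebras, frames and topological spaces. -/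

import Mathlib

open CategoryTheory

universe u

namespace MTStone

/-! ### McKinsey–Tarski algebras -/

/-- An MT-algebra: a complete boolean algebra with an interior operator `box`. -/
structure MTAlg : Type (u + 1) where
  carrier : Type u
  [str : CompleteBooleanAlgebra carrier]
  box : carrier → carrier
  box_top : box ⊤ = ⊤
  box_inf : ∀ a b, box (a ⊓ b) = box a ⊓ box b
  box_le : ∀ a, box a ≤ a
  box_le_box_box : ∀ a, box a ≤ box (box a)

attribute [instance] MTAlg.str

instance : CoeSort MTAlg.{u} (Type u) := ⟨MTAlg.carrier⟩

/-- An MT-morphism: a complete boolean homomorphism `f` with `f (□ a) ≤ □ (f a)`.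
A map between complete boolean algebras that preserves all joins and all meets automatically
preserves complements. -/
@[ext]
structure MTHom (M N : MTAlg.{u}) where
  hom : CompleteLatticeHom M N
  map_box_le : ∀ a : M, hom (M.box a) ≤ N.box (hom a)

namespace MTAlg

variable (M : MTAlg.{u})

theorem box_mono {a b : M} (h : a ≤ b) : M.box a ≤ M.box b := by
  have h1 := M.box_inf a b
  rw [inf_eq_left.mpr h] at h1
  exact inf_eq_left.mp h1.symm

theorem box_box (a : M) : M.box (M.box a) = M.box a :=
  le_antisymm (M.box_le _) (M.box_le_box_box a)

/-- The closure operator `◇ = ¬ □ ¬`. -/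
def dia (a : M) : M := (M.box aᶜ)ᶜ

def IsOpenElt (a : M) : Prop := M.box a = a

def IsClosedElt (a : M) : Prop := M.dia a = a

def IsClopenElt (a : M) : Prop := M.IsClosedElt a ∧ M.IsOpenElt a

/-- Saturated elements: the meets of open elements. -/
def IsSaturatedElt (a : M) : Prop :=
  ∃ S : Set M, (∀ u ∈ S, M.IsOpenElt u) ∧ a = sInf S

/-- Compact elements: every cover by open elements has a finite subcover. -/
def IsCompactElt (a : M) : Prop :=
  ∀ S : Set M, (∀ u ∈ S, M.IsOpenElt u) → a ≤ sSup S →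
    ∃ T : Set M, T ⊆ S ∧ T.Finite ∧ a ≤ sSup T

/-- `a ⊲ b`: there is a compact element between `a` and `b`. -/
def Tri (a b : M) : Prop := ∃ k : M, M.IsCompactElt k ∧ a ≤ k ∧ k ≤ b

/-- Elements approximated from above by regular closed elements. -/
def IsApproxElt (a : M) : Prop :=
  a = sInf {d : M | ∃ c : M, a ≤ M.box c ∧ d = M.dia (M.box c)}

/-- The set `S` join-generates `M`. -/
def JoinGenerates (S : Set M) : Prop := ∀ a : M, a = sSup {b : M | b ∈ S ∧ b ≤ a}

/-- `M` is compact: its top element is compact. -/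
def IsCompactAlg : Prop := M.IsCompactElt ⊤

def IsLocallyCompactAlg : Prop :=
  ∀ a : M, M.IsOpenElt a → a = sSup {v : M | M.IsOpenElt v ∧ M.Tri v a}

def IsT1Alg : Prop := M.JoinGenerates {c | M.IsClosedElt c}

def IsHausdorffAlg : Prop := M.JoinGenerates {c | M.IsApproxElt c}

def IsZeroDimAlg : Prop :=
  M.IsT1Alg ∧ ∀ a : M, M.IsOpenElt a → a = sSup {b : M | M.IsClopenElt b ∧ b ≤ a}

/-- Locally Stone MT-algebras. -/
def IsLocallyStoneAlg : Prop :=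
  M.IsZeroDimAlg ∧ M.IsLocallyCompactAlg ∧ M.IsHausdorffAlg

instance : Category MTAlg.{u} where
  Hom M N := MTHom M N
  id M := ⟨CompleteLatticeHom.id M, fun _ => le_rfl⟩
  comp f g := ⟨g.hom.comp f.hom, fun a =>
    le_trans (OrderHomClass.mono g.hom (f.map_box_le a)) (g.map_box_le (f.hom a))⟩

variable {M}

theorem id_hom_apply (a : M) : MTHom.hom (𝟙 M) a = a := rfl

theorem comp_hom_apply {N K : MTAlg.{u}} (f : M ⟶ N) (g : N ⟶ K) (a : M) :
    MTHom.hom (f ≫ g) a = MTHom.hom g (MTHom.hom f a) := rfl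

theorem hom_ext {N : MTAlg.{u}} {f g : M ⟶ N} (h : ∀ a : M, MTHom.hom f a = MTHom.hom g a) :
    f = g :=
  MTHom.ext (DFunLike.ext _ _ h)

theorem IsOpenElt.map {N : MTAlg.{u}} (f : M ⟶ N) {a : M} (ha : M.IsOpenElt a) :
    N.IsOpenElt (MTHom.hom f a) := by
  refine le_antisymm (N.box_le _) ?_
  have h := MTHom.map_box_le f a
  rwa [ha] at h

theorem isOpenElt_sSup {S : Set M} (hS : ∀ u ∈ S, M.IsOpenElt u) : M.IsOpenElt (sSup S) := by
  refine le_antisymm (M.box_le _) (sSup_le fun u hu => ?_)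
  calc u = M.box u := (hS u hu).symm
    _ ≤ M.box (sSup S) := M.box_mono (le_sSup hu)

theorem isOpenElt_inf {a b : M} (ha : M.IsOpenElt a) (hb : M.IsOpenElt b) :
    M.IsOpenElt (a ⊓ b) := by
  unfold IsOpenElt at *
  rw [M.box_inf, ha, hb]

theorem isOpenElt_sup {a b : M} (ha : M.IsOpenElt a) (hb : M.IsOpenElt b) :
    M.IsOpenElt (a ⊔ b) := by
  rw [← sSup_pair]
  refine isOpenElt_sSup ?_
  rintro u (rfl | rfl) <;> assumption

theorem isOpenElt_bot : M.IsOpenElt ⊥ := le_antisymm (M.box_le _) bot_le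

variable (M)

/-- The frame `O(M)` of open elements, ordered as in `M`. -/
abbrev Opens : Type u := {a : M // M.IsOpenElt a}

/-- Finite meets and arbitrary joins are computed in `M`. -/
instance : CompleteLattice M.Opens where
  inf a b := ⟨a.1 ⊓ b.1, isOpenElt_inf a.2 b.2⟩
  inf_le_left _ _ := inf_le_left (α := M)
  inf_le_right _ _ := inf_le_right (α := M)
  le_inf _ _ _ h h' := le_inf (α := M) h h'
  sup a b := ⟨a.1 ⊔ b.1, isOpenElt_sup a.2 b.2⟩
  le_sup_left _ _ := le_sup_left (α := M)
  le_sup_right _ _ := le_sup_right (α := M)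
  sup_le _ _ _ h h' := sup_le (α := M) h h'
  top := ⟨⊤, M.box_top⟩
  le_top _ := le_top (α := M)
  bot := ⟨⊥, isOpenElt_bot⟩
  bot_le _ := bot_le (α := M)
  sSup S := ⟨sSup (Subtype.val '' S), isOpenElt_sSup (by rintro _ ⟨a, _, rfl⟩; exact a.2)⟩
  isLUB_sSup S := by
    refine ⟨fun a ha => le_sSup (α := M) (Set.mem_image_of_mem Subtype.val ha),
      fun b hb => sSup_le (α := M) ?_⟩
    rintro _ ⟨a, ha, rfl⟩
    exact hb ha
  sInf S := ⟨M.box (sInf (Subtype.val '' S)), M.box_box _⟩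
  isGLB_sInf S := by
    refine ⟨fun a ha => le_trans (α := M) (M.box_le _) 
      (sInf_le (α := M) (Set.mem_image_of_mem Subtype.val ha)), fun b hb => ?_⟩
    have h : b.1 ≤ sInf (Subtype.val '' S) := by
      refine le_sInf (α := M) ?_
      rintro _ ⟨a, ha, rfl⟩
      exact hb ha
    have h' := M.box_mono h
    rw [b.2] at h'
    exact h'

instance : Order.Frame M.Opens := Order.Frame.ofMinimalAxioms
  { inf_sSup_le_iSup_inf := fun a S => by
      have h : a.1 ⊓ sSup (Subtype.val '' S) ≤ (⨆ b ∈ S, a ⊓ b : M.Opens).1 := by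
        rw [inf_sSup_eq]
        refine iSup₂_le ?_
        rintro _ ⟨b, hb, rfl⟩
        exact le_iSup₂ (f := fun (b : M.Opens) (_ : b ∈ S) => a ⊓ b) b hb
      exact h }

end MTAlg

/-- The functor `O : MT ⥤ Frm` taking open elements and restricting MT-morphisms to them. -/
def opensFunctor : MTAlg.{u} ⥤ Frm.{u} where
  obj M := Frm.of M.Opens
  map {M N} f := Frm.ofHom
    { toFun := fun a => ⟨MTHom.hom f a.1, a.2.map f⟩
      map_inf' := fun a b => Subtype.ext (map_inf (MTHom.hom f) a.1 b.1)
      map_top' := Subtype.ext (map_top (MTHom.hom f))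
      map_sSup' := fun S => Subtype.ext (by
        change MTHom.hom f (sSup (Subtype.val '' S)) = sSup (Subtype.val '' (_ '' S))
        rw [map_sSup, Set.image_image, Set.image_image]) }

/-- The contravariant functor `P` sending a space `X` to its powerset with the topological
interior operator, and a continuous map to the preimage map. -/
def powersetFunctor : TopCat.{u}ᵒᵖ ⥤ MTAlg.{u} where
  obj X :=
    { carrier := Set X.unop
      box := interior
      box_top := interior_univ
      box_inf := fun _ _ => interior_inter
      box_le := fun _ => interior_subset
      box_le_box_box := fun _ => interior_interior.ge }
  map {X Y} f :=
    { hom := CompleteLatticeHom.setPreimage f.unop.hom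
      map_box_le := fun _ => preimage_interior_subset_interior_preimage f.unop.hom.continuous }

/-- The set of atoms of an MT-algebra. -/
def Atoms (M : MTAlg.{u}) : Type u := {x : M // IsAtom x}

/-- `η(a) = {x atom | x ≤ a}`. -/
def eta (M : MTAlg.{u}) (a : M) : Set (Atoms M) := {x | x.1 ≤ a}

theorem atom_le_sSup {M : MTAlg.{u}} (x : Atoms M) (S : Set M) (h : x.1 ≤ sSup S) :
    ∃ a ∈ S, x.1 ≤ a := by
  by_contra hc
  push Not at hc
  have h1 : sSup S ≤ x.1ᶜ := sSup_le fun a ha =>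
    (x.2.not_le_iff_disjoint.mp (hc a ha)).symm.le_compl_right
  exact x.2.1 (le_bot_iff.mp (by simpa using le_inf le_rfl (h.trans h1)))

/-- The topology on the atoms of `M`: the open sets are the `η(u)` for `u` open in `M`. -/
instance (M : MTAlg.{u}) : TopologicalSpace (Atoms M) where
  IsOpen s := ∃ a : M, M.IsOpenElt a ∧ s = eta M a
  isOpen_univ := ⟨⊤, M.box_top, by ext; simp [eta]⟩
  isOpen_inter := by
    rintro _ _ ⟨a, ha, rfl⟩ ⟨b, hb, rfl⟩
    exact ⟨a ⊓ b, MTAlg.isOpenElt_inf ha hb, by ext; simp [eta]⟩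
  isOpen_sUnion S hS := by
    refine ⟨sSup {a | M.IsOpenElt a ∧ eta M a ∈ S}, MTAlg.isOpenElt_sSup fun _ h => h.1, ?_⟩
    ext x
    constructor
    · rintro ⟨s, hs, hx⟩
      obtain ⟨a, ha, rfl⟩ := hS s hs
      exact le_trans hx (le_sSup (α := M) ⟨ha, hs⟩)
    · intro hx
      obtain ⟨a, ha, hxa⟩ := atom_le_sSup x _ hx
      exact ⟨_, ha.2, hxa⟩

/-- The left adjoint `f^*` of an MT-morphism `f`. -/
def leftAdj {M N : MTAlg.{u}} (f : M ⟶ N) (x : N) : M := sInf {a : M | x ≤ MTHom.hom f a}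

theorem leftAdj_le_iff {M N : MTAlg.{u}} (f : M ⟶ N) (x : N) (a : M) :
    leftAdj f x ≤ a ↔ x ≤ MTHom.hom f a := by
  constructor
  · intro h
    refine le_trans ?_ (OrderHomClass.mono (MTHom.hom f) h)
    rw [leftAdj, map_sInf]
    refine le_sInf ?_
    rintro _ ⟨b, hb, rfl⟩
    exact hb
  · exact fun h => sInf_le h

theorem isAtom_leftAdj {M N : MTAlg.{u}} (f : M ⟶ N) {x : N} (hx : IsAtom x) :
    IsAtom (leftAdj f x) := by
  refine ⟨fun h => hx.1 ?_, fun b hb => ?_⟩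
  · have h' := (leftAdj_le_iff f x ⊥).mp h.le
    rwa [map_bot, le_bot_iff] at h'
  · have h1 : ¬ x ≤ MTHom.hom f b := fun h => hb.not_ge ((leftAdj_le_iff f x b).mpr h)
    have h2 : x ≤ MTHom.hom f bᶜ := by
      have h3 : x ≤ MTHom.hom f b ⊔ MTHom.hom f bᶜ := by
        rw [← map_sup, sup_compl_eq_top, map_top]; exact le_top
      have h4 := hx.not_le_iff_disjoint.mp h1
      exact Disjoint.left_le_of_le_sup_left h3 h4
    have h5 : b ≤ bᶜ := hb.le.trans ((leftAdj_le_iff f x _).mpr h2)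
    simpa using le_inf le_rfl h5

/-- The contravariant functor `at` sending an MT-algebra to its space of atoms and an
MT-morphism `f` to the restriction of `f^*` to atoms. -/
def atomsFunctor : MTAlg.{u}ᵒᵖ ⥤ TopCat.{u} where
  obj M := TopCat.of (Atoms M.unop)
  map {M N} f := TopCat.ofHom
    { toFun := fun x => ⟨leftAdj f.unop x.1, isAtom_leftAdj f.unop x.2⟩
      continuous_toFun := ⟨by
        rintro _ ⟨a, ha, rfl⟩
        exact ⟨MTHom.hom f.unop a, ha.map f.unop, by
          ext x; exact leftAdj_le_iff f.unop x.1 a⟩⟩ }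
  map_id M := by
    ext x
    refine Subtype.ext (eq_of_forall_ge_iff fun a => ?_)
    exact leftAdj_le_iff (𝟙 M.unop) x.1 a
  map_comp f g := by
    ext x
    refine Subtype.ext (eq_of_forall_ge_iff fun a => ?_)
    refine (leftAdj_le_iff (g.unop ≫ f.unop) x.1 a).trans ?_
    refine Iff.trans ?_ (leftAdj_le_iff g.unop _ a).symm
    exact (leftAdj_le_iff f.unop x.1 _).symm

/-! ### Frames -/

/-- The way-below relation of a frame. -/
def WayBelow {L : Type u} [Order.Frame L] (a b : L) : Prop :=
  ∀ S : Set L, b ≤ sSup S → ∃ T : Set L, T ⊆ S ∧ T.Finite ∧ a ≤ sSup T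

def IsContinuousFrm (L : Frm.{u}) : Prop := ∀ a : L, a = sSup {x : L | WayBelow x a}

/-- Zero-dimensional frames: every element is a join of complemented elements. Here `cᶜ` is the
pseudocomplement of `c`. -/
def IsZeroDimFrm (L : Frm.{u}) : Prop :=
  ∀ a : L, a = sSup {c : L | c ⊔ cᶜ = ⊤ ∧ c ≤ a}

def IsCompactFrm (L : Frm.{u}) : Prop := IsCompactElement (⊤ : L)

/-- Locally Stone frames. -/
def IsLocallyStoneFrm (L : Frm.{u}) : Prop := IsContinuousFrm L ∧ IsZeroDimFrm L

/-! ### Spaces -/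

/-- Zero-dimensional spaces: `T₁` with a basis of clopen sets. -/
def IsZeroDimSpace (X : Type u) [TopologicalSpace X] : Prop :=
  T1Space X ∧ TopologicalSpace.IsTopologicalBasis {s : Set X | IsClopen s}

/-- Locally Stone spaces. -/
def IsLocallyStoneSpace (X : TopCat.{u}) : Prop :=
  IsZeroDimSpace X ∧ LocallyCompactSpace X ∧ T2Space X

/-- Saturated sets: the intersections of open sets. -/
def IsSaturatedSet {X : Type u} [TopologicalSpace X] (s : Set X) : Prop :=
  ∃ S : Set (Set X), (∀ U ∈ S, IsOpen U) ∧ s = ⋂₀ S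

/-! ### Proper morphisms -/

/-- Proper MT-morphisms send compact saturated elements to compact saturated elements. -/
def properMT : MorphismProperty MTAlg.{u} := fun M N f =>
  ∀ a : M, M.IsCompactElt a ∧ M.IsSaturatedElt a →
    N.IsCompactElt (MTHom.hom f a) ∧ N.IsSaturatedElt (MTHom.hom f a)

/-- Proper frame homomorphisms preserve the way-below relation. -/
def properFrm : MorphismProperty Frm.{u} := fun L _ f =>
  ∀ a b : L, WayBelow a b → WayBelow (f.hom a) (f.hom b)

/-- Proper (continuous) maps: preimages of compact saturated sets are compact. -/
def properTop : MorphismProperty TopCat.{u} := fun X Y f =>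
  ∀ K : Set Y, IsCompact K → IsSaturatedSet K → IsCompact (f.hom ⁻¹' K : Set X)

instance : properMT.{u}.IsMultiplicative where
  id_mem _ := fun _ h => h
  comp_mem f _ hf hg := fun a h => hg (MTHom.hom f a) (hf a h)

instance : properFrm.{u}.IsMultiplicative where
  id_mem _ := fun _ _ h => h
  comp_mem _ _ hf hg := fun _ _ h => hg _ _ (hf _ _ h)

theorem IsSaturatedSet.preimage {X Y : Type u} [TopologicalSpace X] [TopologicalSpace Y]
    {f : X → Y} (hf : Continuous f) {K : Set Y} (hK : IsSaturatedSet K) :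
    IsSaturatedSet (f ⁻¹' K) := by
  obtain ⟨S, hS, rfl⟩ := hK
  refine ⟨Set.preimage f '' S, ?_, ?_⟩
  · rintro _ ⟨U, hU, rfl⟩
    exact (hS U hU).preimage hf
  · rw [Set.sInter_image, Set.preimage_sInter]

instance : properTop.{u}.IsMultiplicative where
  id_mem _ := fun _ h _ => h
  comp_mem _ g hf hg := fun _ hK hs =>
    hf _ (hg _ hK hs) (hs.preimage g.hom.continuous)

/-! ### Subcategories and restrictions of functors -/

section Sub

universe v₁ v₂ u₁ u₂

variable {C : Type u₁} [Category.{v₁} C] {D : Type u₂} [Category.{v₂} D]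

/-- The subcategory of `C` with the objects satisfying `P` and the morphisms satisfying `W`. -/
structure SubCat (P : ObjectProperty C) (W : MorphismProperty C) where
  obj : C
  property : P obj

namespace SubCat

/-- Morphisms of the subcategory. -/
@[ext]
structure Hom {P : ObjectProperty C} {W : MorphismProperty C} (X Y : SubCat P W) where
  hom : X.obj ⟶ Y.obj
  property : W hom

instance (P : ObjectProperty C) (W : MorphismProperty C) [W.IsMultiplicative] :
    Category.{v₁} (SubCat P W) where
  Hom X Y := SubCat.Hom X Y
  id X := ⟨𝟙 X.obj, W.id_mem _⟩
  comp f g := ⟨f.hom ≫ g.hom, W.comp_mem _ _ f.property g.property⟩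

variable {P : ObjectProperty C} {W : MorphismProperty C} [W.IsMultiplicative]
  {Q : ObjectProperty D} {V : MorphismProperty D} [V.IsMultiplicative]

/-- The restriction of a functor to subcategories. -/
def restrict (F : C ⥤ D) (hobj : ∀ X, P X → Q (F.obj X))
    (hmap : ∀ ⦃X Y : C⦄ (f : X ⟶ Y), P X → P Y → W f → V (F.map f)) :
    SubCat P W ⥤ SubCat Q V where
  obj X := ⟨F.obj X.obj, hobj _ X.property⟩
  map {X Y} f := ⟨F.map f.hom, hmap _ X.property Y.property f.property⟩
  map_id X := SubCat.Hom.ext (F.map_id X.obj)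
  map_comp f g := SubCat.Hom.ext (F.map_comp f.hom g.hom)

/-- The restriction of a contravariant functor to subcategories. -/
def restrictOp (F : Cᵒᵖ ⥤ D) (hobj : ∀ X, P X → Q (F.obj (Opposite.op X)))
    (hmap : ∀ ⦃X Y : C⦄ (f : X ⟶ Y), P X → P Y → W f → V (F.map f.op)) :
    (SubCat P W)ᵒᵖ ⥤ SubCat Q V where
  obj X := ⟨F.obj (Opposite.op X.unop.obj), hobj _ X.unop.property⟩
  map {X Y} f := ⟨F.map f.unop.hom.op, hmap _ Y.unop.property X.unop.property f.unop.property⟩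
  map_id X := SubCat.Hom.ext (F.map_id (Opposite.op X.unop.obj))
  map_comp f g := SubCat.Hom.ext (F.map_comp f.unop.hom.op g.unop.hom.op)

end SubCat

end Sub

/-- The objects of `LStoneMT`, a category whose morphisms are the proper MT-morphisms. -/
def lStoneMT : ObjectProperty MTAlg.{u} := fun M => M.IsLocallyStoneAlg

/-- The objects of `LStoneFrm`, a category whose morphisms are the proper frame homomorphisms. -/
def lStoneFrm : ObjectProperty Frm.{u} := fun L => IsLocallyStoneFrm L

/-- The objects of `LStone`, a category whose morphisms are the proper maps. -/
def lStone : ObjectProperty TopCat.{u} := fun X => IsLocallyStoneSpace X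

/-- The objects of `StoneMT`, the full subcategory of `LStoneMT` of compact MT-algebras. -/
def stoneMT : ObjectProperty MTAlg.{u} := fun M => lStoneMT M ∧ M.IsCompactAlg

/-- The objects of `StoneFrm`, the full subcategory of `LStoneFrm` of compact frames. -/
def stoneFrm : ObjectProperty Frm.{u} := fun L => lStoneFrm L ∧ IsCompactFrm L

/-- The objects of `Stone`, the full subcategory of `LStone` of compact spaces. -/
def stone : ObjectProperty TopCat.{u} := fun X => lStone X ∧ CompactSpace X

/-- `O` restricts to a functor between the two given subcategories, and this restriction is an
equivalence. -/
def OpensRestrictsToEquivalence (P : ObjectProperty MTAlg.{u}) (Q : ObjectProperty Frm.{u}) :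
    Prop :=
  ∃ (hobj : ∀ M, P M → Q (opensFunctor.obj M))
    (hmap : ∀ ⦃M N : MTAlg.{u}⦄ (f : M ⟶ N), P M → P N → properMT f →
      properFrm (opensFunctor.map f)),
    (SubCat.restrict (P := P) (Q := Q) opensFunctor hobj hmap).IsEquivalence

/-- The contravariant functors `at` and `P` restrict to the two given subcategories, and these
restrictions form a dual equivalence, through natural isomorphisms whose components are
`a ↦ {x atom | x ≤ a}` and `x ↦ {x}`. -/
def AtomsPowersetRestrictToDualEquivalence (P : ObjectProperty MTAlg.{u})
    (Q : ObjectProperty TopCat.{u}) : Prop :=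
  ∃ (atObj : ∀ M, P M → Q (atomsFunctor.obj (Opposite.op M)))
    (atMap : ∀ ⦃M N : MTAlg.{u}⦄ (f : M ⟶ N), P M → P N → properMT f →
      properTop (atomsFunctor.map f.op))
    (powObj : ∀ X, Q X → P (powersetFunctor.obj (Opposite.op X)))
    (powMap : ∀ ⦃X Y : TopCat.{u}⦄ (f : X ⟶ Y), Q X → Q Y → properTop f →
      properMT (powersetFunctor.map f.op)),
    let A : (SubCat P properMT)ᵒᵖ ⥤ SubCat Q properTop :=
      SubCat.restrictOp atomsFunctor atObj atMap
    let B : (SubCat Q properTop)ᵒᵖ ⥤ SubCat P properMT :=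
      SubCat.restrictOp powersetFunctor powObj powMap
    A.IsEquivalence ∧ B.IsEquivalence ∧
    (∃ η : 𝟭 (SubCat P properMT) ≅ A.rightOp ⋙ B,
      ∀ (M : SubCat P properMT) (a : M.obj),
        MTHom.hom (SubCat.Hom.hom (η.hom.app M)) a = eta M.obj a) ∧
    (∃ ε : 𝟭 (SubCat Q properTop) ≅ B.rightOp ⋙ A,
      ∀ (X : SubCat Q properTop) (x : X.obj),
        Subtype.val (TopCat.Hom.hom (SubCat.Hom.hom (ε.hom.app X)) x) = ({x} : Set X.obj))

end MTStone

open MTStone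

namespace MTStone

/-! ### Maximal elements not above a compact element -/

/-! Everything rests on one fact: a locally Stone MT-algebra `M` is the powerset of its space of
atoms. Local compactness and zero-dimensionality make every open element a join of compact clopen
elements (`eq_sSup_compact_clopen`). Under a nonzero element one finds a nonzero compact closed `c`;
by Zorn some open `m` is maximal among those not above `c`, and `T₁` makes `c ⊓ mᶜ` an atom
(`exists_atom_le`). So `eta` is an order isomorphism onto the powerset that carries `box` to
interior, and topological properties pass back and forth along it. Naturality of both unit maps is
the adjunction `leftAdj_le_iff`.

For frames, `opensFunctor` is faithful because closed elements join-generate, full because a frame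
homomorphism between frames of open elements induces a map of atoms whose preimage map extends it,
and essentially surjective because a locally Stone frame is spatial (again by Zorn, below a compact
complemented element) and hence is the frame of opens of its space of points.

Properness matches on all sides because `u ≪ v` in the frame of opens means that a compact clopen
element lies between `u` and `v`, while compact elements are closed. -/

theorem exists_maximal_not_ge {α : Type*} [CompleteLattice α] {O : Set α}
    (hO : ∀ S ⊆ O, sSup S ∈ O) {c : α}
    (hc : ∀ S ⊆ O, c ≤ sSup S → ∃ T ⊆ S, T.Finite ∧ c ≤ sSup T)
    {b : α} (hbO : b ∈ O) (hb : ¬ c ≤ b) :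
    ∃ m, b ≤ m ∧ Maximal (· ∈ {u | u ∈ O ∧ ¬ c ≤ u}) m := by
  refine zorn_le_nonempty₀ _ (fun C hC hchain y hy => ?_) b ⟨hbO, hb⟩
  refine ⟨sSup C, ⟨hO C fun u hu => (hC hu).1, fun hle => ?_⟩, fun z hz => le_sSup hz⟩
  obtain ⟨T, hTC, hTfin, hcT⟩ := hc C (fun u hu => (hC hu).1) hle
  -- A finite part of a chain is bounded by a member of the chain; `y` serves when `T` is empty.
  obtain ⟨z, hz, hzT⟩ : ∃ z ∈ C, ∀ t ∈ T, t ≤ z := by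
    clear hcT
    induction T, hTfin using Set.Finite.induction_on with
    | empty => exact ⟨y, hy, by simp⟩
    | @insert a s _ _ ih =>
      obtain ⟨z, hz, hzs⟩ := ih ((Set.subset_insert a s).trans hTC)
      obtain ⟨w, hw, haw, hzw⟩ := hchain.directedOn a (hTC (Set.mem_insert a s)) z hz
      refine ⟨w, hw, ?_⟩
      rintro t (rfl | ht)
      · exact haw
      · exact (hzs t ht).trans hzw
  exact (hC hz).2 (hcT.trans (sSup_le hzT))

theorem isComplemented_sSup_of_finite {α : Type*} [Order.Frame α] {T : Set α} (hT : T.Finite)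
    (h : ∀ c ∈ T, IsComplemented c) : IsComplemented (sSup T) := by
  induction T, hT using Set.Finite.induction_on with
  | empty => simpa using isComplemented_bot
  | @insert a s _ _ ih =>
    rw [sSup_insert]
    exact (h a (Set.mem_insert a s)).sup (ih fun c hc => h c (Set.mem_insert_of_mem a hc))

namespace MTAlg

variable {M : MTAlg.{u}}

/-! ### Open, closed and clopen elements -/

theorem isClosedElt_iff {a : M} : M.IsClosedElt a ↔ M.IsOpenElt aᶜ := by
  unfold IsClosedElt IsOpenElt dia
  rw [compl_eq_comm, eq_comm]

theorem isClosedElt_compl_iff {a : M} : M.IsClosedElt aᶜ ↔ M.IsOpenElt a := by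
  rw [isClosedElt_iff, compl_compl]

theorem IsClopenElt.compl {a : M} (h : M.IsClopenElt a) : M.IsClopenElt aᶜ :=
  ⟨isClosedElt_compl_iff.mpr h.2, isClosedElt_iff.mp h.1⟩

theorem isClopenElt_sSup_of_finite {T : Set M} (hT : T.Finite) (h : ∀ a ∈ T, M.IsClopenElt a) :
    M.IsClopenElt (sSup T) := by
  refine ⟨?_, isOpenElt_sSup fun a ha => (h a ha).2⟩
  induction T, hT using Set.Finite.induction_on with
  | empty =>
    rw [sSup_empty, isClosedElt_iff, compl_bot]
    exact M.box_top
  | @insert a s _ _ ih =>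
    rw [sSup_insert, isClosedElt_iff, compl_sup]
    exact isOpenElt_inf (isClosedElt_iff.mp (h a (Set.mem_insert a s)).1)
      (isClosedElt_iff.mp (ih fun c hc => h c (Set.mem_insert_of_mem a hc)))

theorem IsClosedElt.map {N : MTAlg.{u}} (f : M ⟶ N) {a : M} (ha : M.IsClosedElt a) :
    N.IsClosedElt (MTHom.hom f a) := by
  rw [isClosedElt_iff] at ha ⊢
  rw [← map_compl']
  exact ha.map f

theorem IsSaturatedElt.map {N : MTAlg.{u}} (f : M ⟶ N) {a : M} (ha : M.IsSaturatedElt a) :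
    N.IsSaturatedElt (MTHom.hom f a) := by
  obtain ⟨S, hS, rfl⟩ := ha
  refine ⟨MTHom.hom f '' S, ?_, map_sInf _ _⟩
  rintro _ ⟨u, hu, rfl⟩
  exact (hS u hu).map f

/-! ### `T₁` MT-algebras -/

/-- Dual to `T₁`: complements of closed elements are open. Hence saturation is automatic in the
definition of proper MT-morphism, and only compactness matters. -/
theorem IsT1Alg.isSaturatedElt (hM : M.IsT1Alg) (a : M) : M.IsSaturatedElt a := by
  refine ⟨{u | M.IsOpenElt u ∧ a ≤ u}, fun u hu => hu.1,
    le_antisymm (le_sInf fun u hu => hu.2) ?_⟩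
  rw [← compl_le_compl_iff_le]
  conv_lhs => rw [hM aᶜ]
  refine sSup_le fun c hc => ?_
  rw [le_compl_comm]
  exact sInf_le ⟨isClosedElt_iff.mp hc.1, le_compl_comm.mp hc.2⟩

theorem IsT1Alg.exists_closed_le (hM : M.IsT1Alg) {a : M} (ha : a ≠ ⊥) :
    ∃ c, M.IsClosedElt c ∧ c ≠ ⊥ ∧ c ≤ a := by
  by_contra! h
  refine ha ?_
  rw [hM a, sSup_eq_bot]
  intro c hc
  by_contra hne
  exact h c hc.1 hne hc.2

theorem IsT1Alg.isClosedElt_of_isAtom (hM : M.IsT1Alg) {x : M} (hx : IsAtom x) :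
    M.IsClosedElt x := by
  obtain ⟨c, hc, hne, hle⟩ := hM.exists_closed_le hx.1
  rwa [← (hx.le_iff_eq hne).mp hle]

/-! ### Compact elements -/

/-- Adding the open element `bᶜ` to a cover of `b` gives a cover of `k`; `bᶜ` can be dropped from
the finite subcover since it is disjoint from `b`. -/
theorem IsCompactElt.of_isClosedElt_le {b k : M} (hk : M.IsCompactElt k) (hb : M.IsClosedElt b)
    (hbk : b ≤ k) : M.IsCompactElt b := by
  intro S hS hbS
  obtain ⟨T, hTS, hT, hkT⟩ := hk (insert bᶜ S)
    (by
      rintro u (rfl | hu)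
      · exact isClosedElt_iff.mp hb
      · exact hS u hu)
    (by
      rw [sSup_insert]
      refine le_top.trans ?_
      rw [← compl_sup_eq_top (x := b)]
      exact sup_le_sup_left hbS _)
  refine ⟨T \ {bᶜ}, ?_, hT.sdiff, ?_⟩
  · rintro u ⟨hu, hne⟩
    exact (hTS hu).resolve_left hne
  · have h : b ≤ bᶜ ⊔ sSup (T \ {bᶜ}) := by
      rw [← sSup_insert]
      exact (hbk.trans hkT).trans (sSup_le_sSup (by rw [Set.insert_sdiff_singleton]; simp))
    exact disjoint_compl_right.left_le_of_le_sup_left h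

theorem isCompactElt_sSup_of_finite {T : Set M} (hT : T.Finite)
    (h : ∀ a ∈ T, M.IsCompactElt a) : M.IsCompactElt (sSup T) := by
  induction T, hT using Set.Finite.induction_on with
  | empty => exact fun S _ _ => ⟨∅, Set.empty_subset S, Set.finite_empty, by simp⟩
  | @insert a s _ _ ih =>
    intro S hS hle
    rw [sSup_insert, sup_le_iff] at hle
    obtain ⟨T₁, h₁, hf₁, hle₁⟩ := h a (Set.mem_insert a s) S hS hle.1
    obtain ⟨T₂, h₂, hf₂, hle₂⟩ := ih (fun c hc => h c (Set.mem_insert_of_mem a hc)) S hS hle.2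
    refine ⟨T₁ ∪ T₂, Set.union_subset h₁ h₂, hf₁.union hf₂, ?_⟩
    rw [sSup_insert, sSup_union]
    exact sup_le_sup hle₁ hle₂

theorem IsCompactElt.exists_clopen_between {k u : M} (hM : M.IsZeroDimAlg)
    (hk : M.IsCompactElt k) (hu : M.IsOpenElt u) (hku : k ≤ u) :
    ∃ w, M.IsClopenElt w ∧ k ≤ w ∧ w ≤ u := by
  rw [hM.2 u hu] at hku
  obtain ⟨T, hTS, hT, hkT⟩ := hk _ (fun b hb => hb.1.2) hku
  exact ⟨sSup T, isClopenElt_sSup_of_finite hT fun b hb => (hTS hb).1, hkT,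
    sSup_le fun b hb => (hTS hb).2⟩

/-! ### Locally Stone MT-algebras -/

theorem IsLocallyStoneAlg.isT1Alg (hM : M.IsLocallyStoneAlg) : M.IsT1Alg := hM.1.1

/-- A clopen element below an open `v` with `v ≤ l`, `l` compact, is closed below `l`, hence
compact. -/
theorem IsLocallyStoneAlg.eq_sSup_compact_clopen (hM : M.IsLocallyStoneAlg) {u : M}
    (hu : M.IsOpenElt u) :
    u = sSup {w | M.IsClopenElt w ∧ M.IsCompactElt w ∧ w ≤ u} := by
  refine le_antisymm ?_ (sSup_le fun w hw => hw.2.2)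
  conv_lhs => rw [hM.2.1 u hu]
  refine sSup_le ?_
  rintro v ⟨hv, l, hl, hvl, hlu⟩
  rw [hM.1.2 v hv]
  exact sSup_le fun b hb => le_sSup
    ⟨hb.1, hl.of_isClosedElt_le hb.1.1 (hb.2.trans hvl), (hb.2.trans hvl).trans hlu⟩

theorem IsLocallyStoneAlg.exists_compact_clopen_between (hM : M.IsLocallyStoneAlg) {k u : M}
    (hk : M.IsCompactElt k) (hu : M.IsOpenElt u) (hku : k ≤ u) :
    ∃ w, M.IsClopenElt w ∧ M.IsCompactElt w ∧ k ≤ w ∧ w ≤ u := by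
  rw [hM.eq_sSup_compact_clopen hu] at hku
  obtain ⟨T, hTS, hT, hkT⟩ := hk _ (fun b hb => hb.1.2) hku
  exact ⟨sSup T, isClopenElt_sSup_of_finite hT fun b hb => (hTS hb).1,
    isCompactElt_sSup_of_finite hT fun b hb => (hTS hb).2.1, hkT,
    sSup_le fun b hb => (hTS hb).2.2⟩

/-- Nonzero elements of a locally Stone MT-algebra have atoms below them. -/
theorem IsLocallyStoneAlg.exists_atom_le (hM : M.IsLocallyStoneAlg) {a : M} (ha : a ≠ ⊥) :
    ∃ x, IsAtom x ∧ x ≤ a := by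
  -- The compact clopen elements join to `⊤`, so one of them meets `a`.
  obtain ⟨w, hwc, hne⟩ : ∃ w, M.IsCompactElt w ∧ a ⊓ w ≠ ⊥ := by
    by_contra! h
    refine ha ?_
    have htop := hM.eq_sSup_compact_clopen M.box_top
    rw [← inf_top_eq a, htop, inf_sSup_eq, iSup₂_eq_bot]
    exact fun w hw => h w hw.2.1
  obtain ⟨c, hc, hcne, hcle⟩ := hM.isT1Alg.exists_closed_le hne
  have hcc : M.IsCompactElt c := hwc.of_isClosedElt_le hc (hcle.trans inf_le_right)
  obtain ⟨m, -, hm⟩ := exists_maximal_not_ge (O := {u : M | M.IsOpenElt u}) (c := c) (b := ⊥)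
    (fun S hS => isOpenElt_sSup hS) (fun S hS h => hcc S hS h) isOpenElt_bot
    (by rwa [le_bot_iff])
  -- A nonzero `b` strictly below `c ⊓ mᶜ` would contain a nonzero closed `d`. The open element `m ⊔
  -- dᶜ` is still not above `c`, so maximality gives `dᶜ ≤ m`, that is `mᶜ ≤ d ≤ b`, a
  -- contradiction.
  refine ⟨c ⊓ mᶜ, ⟨fun h => hm.prop.2 ?_, fun b hb => ?_⟩,
    inf_le_left.trans (hcle.trans inf_le_left)⟩
  · rwa [← sdiff_eq, sdiff_eq_bot_iff] at h
  · by_contra hbne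
    obtain ⟨d, hd, hdne, hdb⟩ := hM.isT1Alg.exists_closed_le hbne
    have hdm : d ≤ c ⊓ mᶜ := hdb.trans hb.le
    have hcm : ¬ c ≤ m ⊔ dᶜ := fun h => by
      have h1 : d ≤ dᶜ := (le_inf (hdm.trans inf_le_left |>.trans h)
        (hdm.trans inf_le_right)).trans (by rw [inf_sup_right]; simp)
      exact hdne (by simpa using le_inf le_rfl h1)
    have h2 := hm.le_of_ge ⟨isOpenElt_sup hm.prop.1 (isClosedElt_iff.mp hd), hcm⟩ le_sup_left
    have h3 : c ⊓ mᶜ ≤ d := inf_le_right.trans (compl_le_iff_compl_le.mp (le_sup_right.trans h2))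
    exact absurd (h3.trans hdb) hb.not_ge

theorem IsLocallyStoneAlg.le_of_forall_atom (hM : M.IsLocallyStoneAlg) {a b : M}
    (h : ∀ x, IsAtom x → x ≤ a → x ≤ b) : a ≤ b := by
  by_contra hab
  obtain ⟨x, hx, hle⟩ := hM.exists_atom_le (a := a \ b) (by rwa [Ne, sdiff_eq_bot_iff])
  refine hx.1 ?_
  have h1 := le_inf (h x hx (hle.trans sdiff_le)) hle
  simpa using h1

/-- Compact elements of a locally Stone MT-algebra are closed. -/
theorem IsLocallyStoneAlg.isClosedElt_of_isCompactElt (hM : M.IsLocallyStoneAlg) {k : M}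
    (hk : M.IsCompactElt k) : M.IsClosedElt k := by
  -- An atom `x` below `kᶜ` is closed, so a clopen `w` fits between `k` and the open `xᶜ`; then `wᶜ`
  -- is an open element between `x` and `kᶜ`.
  have h : kᶜ = sSup {v | M.IsOpenElt v ∧ v ≤ kᶜ} := by
    refine le_antisymm (hM.le_of_forall_atom fun x hx hxk => ?_) (sSup_le fun v hv => hv.2)
    obtain ⟨w, hw, hkw, hwx⟩ := hk.exists_clopen_between hM.1
      (isClosedElt_iff.mp (hM.isT1Alg.isClosedElt_of_isAtom hx)) (le_compl_comm.mp hxk)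
    exact (le_compl_comm.mp hwx).trans (le_sSup ⟨hw.compl.2, compl_le_compl hkw⟩)
  rw [isClosedElt_iff, h]
  exact isOpenElt_sSup fun v hv => hv.1

/-- MT-morphisms from a locally Stone MT-algebra to a compact one are proper. -/
theorem properMT_of_isCompactAlg {N : MTAlg.{u}} (f : M ⟶ N) (hM : M.IsLocallyStoneAlg)
    (hN : N.IsCompactAlg) : properMT f := fun _ ha =>
  ⟨IsCompactElt.of_isClosedElt_le hN ((hM.isClosedElt_of_isCompactElt ha.1).map f) le_top,
    ha.2.map f⟩

end MTAlg

/-! ### The space of atoms -/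

section Atoms

variable {M : MTAlg.{u}}

theorem mem_eta {a : M} {x : Atoms M} : x ∈ eta M a ↔ x.1 ≤ a := Iff.rfl

theorem isOpen_eta {a : M} (ha : M.IsOpenElt a) : IsOpen (eta M a) := ⟨a, ha, rfl⟩

theorem eta_sSup (S : Set M) : eta M (sSup S) = ⋃ a ∈ S, eta M a := by
  ext x
  simp only [Set.mem_iUnion, mem_eta, exists_prop]
  exact ⟨atom_le_sSup x S, fun ⟨a, ha, h⟩ => h.trans (le_sSup ha)⟩

theorem eta_sSup_image (s : Set (Atoms M)) : eta M (sSup (Subtype.val '' s)) = s := by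
  rw [eta_sSup]
  ext x
  simp only [Set.mem_iUnion, exists_prop]
  constructor
  · rintro ⟨_, ⟨y, hy, rfl⟩, h⟩
    have : x = y := Subtype.ext ((y.2.le_iff_eq x.2.1).mp h)
    rwa [this]
  · exact fun hx => ⟨x.1, ⟨x, hx, rfl⟩, le_rfl⟩

theorem eta_val (x : Atoms M) : eta M x.1 = {x} :=
  Set.ext fun y => (x.2.le_iff_eq y.2.1).trans Subtype.ext_iff.symm

theorem eta_compl (a : M) : eta M aᶜ = (eta M a)ᶜ := by
  ext x
  rw [Set.mem_compl_iff, mem_eta, mem_eta, x.2.not_le_iff_disjoint, le_compl_iff_disjoint_right]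

theorem isClopen_eta {a : M} (ha : M.IsClopenElt a) : IsClopen (eta M a) :=
  ⟨⟨by rw [← eta_compl]; exact isOpen_eta ha.compl.2⟩, isOpen_eta ha.2⟩

end Atoms

namespace MTAlg

variable {M N : MTAlg.{u}}

theorem IsLocallyStoneAlg.eta_subset_iff (hM : M.IsLocallyStoneAlg) {a b : M} :
    eta M a ⊆ eta M b ↔ a ≤ b :=
  ⟨fun h => hM.le_of_forall_atom fun x hx hxa => @h ⟨x, hx⟩ hxa, fun h _ hx => le_trans hx h⟩

/-- A locally Stone MT-algebra is, as a lattice, the powerset of its set of atoms. -/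
def IsLocallyStoneAlg.etaOrderIso (hM : M.IsLocallyStoneAlg) : M ≃o Set (Atoms M) where
  toFun := eta M
  invFun s := sSup (Subtype.val '' s)
  left_inv a := by
    refine le_antisymm ?_ ?_ <;> rw [← hM.eta_subset_iff, eta_sSup_image]
  right_inv := eta_sSup_image
  map_rel_iff' := hM.eta_subset_iff

theorem IsLocallyStoneAlg.eta_box (hM : M.IsLocallyStoneAlg) (a : M) :
    eta M (M.box a) = interior (eta M a) := by
  refine Set.Subset.antisymm
    (interior_maximal (hM.eta_subset_iff.mpr (M.box_le a)) (isOpen_eta (M.box_box a))) ?_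
  -- The interior is `eta M u` for some open `u`; since `eta` reflects order, `u ≤ a`, so `u ≤ M.box
  -- a`.
  obtain ⟨u, hu, h⟩ := isOpen_interior (s := eta M a)
  rw [h, hM.eta_subset_iff, ← hu]
  exact M.box_mono (hM.eta_subset_iff.mp (h ▸ interior_subset))

/-! ### Isomorphisms of MT-algebras -/

/-- The MT-morphism given by an order isomorphism that preserves `box`. -/
def homOfOrderIso (e : M ≃o N) (he : ∀ a, e (M.box a) = N.box (e a)) : M ⟶ N where
  hom := CompleteLatticeHom.OrderIso.toCompleteLatticeHom e
  map_box_le a := (he a).le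

theorem orderIso_symm_box {e : M ≃o N} (he : ∀ a, e (M.box a) = N.box (e a)) (b : N) :
    e.symm (N.box b) = M.box (e.symm b) := by
  rw [OrderIso.symm_apply_eq, he, e.apply_symm_apply]

theorem IsCompactElt.map_orderIso {e : M ≃o N} (he : ∀ a, e (M.box a) = N.box (e a)) {k : M}
    (hk : M.IsCompactElt k) : N.IsCompactElt (e k) := by
  intro S hS hle
  obtain ⟨T, hTS, hT, hkT⟩ := hk (e.symm '' S)
    (by
      rintro _ ⟨u, hu, rfl⟩
      exact (orderIso_symm_box he u).symm.trans (congrArg e.symm (hS u hu)))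
    (by rwa [← map_sSup, e.le_symm_apply])
  obtain ⟨T, hTS', rfl⟩ := Set.subset_image_iff.mp hTS
  refine ⟨T, hTS', hT.of_finite_image e.symm.injective.injOn, ?_⟩
  rwa [← map_sSup, e.le_symm_apply] at hkT

theorem properMT_homOfOrderIso (e : M ≃o N) (he : ∀ a, e (M.box a) = N.box (e a)) :
    properMT (homOfOrderIso e he) := fun _ ha =>
  ⟨ha.1.map_orderIso he, ha.2.map (homOfOrderIso e he)⟩

/-- The isomorphism given by an order isomorphism that preserves `box`. -/
def isoOfOrderIso {P : ObjectProperty MTAlg.{u}} {X Y : SubCat P properMT} (e : X.obj ≃o Y.obj)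
    (he : ∀ a, e (X.obj.box a) = Y.obj.box (e a)) : X ≅ Y where
  hom := ⟨homOfOrderIso e he, properMT_homOfOrderIso e he⟩
  inv := ⟨homOfOrderIso e.symm (orderIso_symm_box he),
    properMT_homOfOrderIso e.symm (orderIso_symm_box he)⟩
  hom_inv_id := SubCat.Hom.ext (hom_ext fun a => e.symm_apply_apply a)
  inv_hom_id := SubCat.Hom.ext (hom_ext fun a => e.apply_symm_apply a)

end MTAlg

/-! ### Powersets of spaces -/

section Powerset

variable {X : TopCat.{u}}

theorem isOpenElt_powerset_iff {s : Set X} :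
    (powersetFunctor.obj (.op X)).IsOpenElt s ↔ IsOpen s :=
  interior_eq_iff_isOpen

theorem dia_powerset (s : Set X) :
    (powersetFunctor.obj (.op X)).dia s = closure s := by
  change (interior sᶜ)ᶜ = closure s
  rw [interior_compl, compl_compl]

theorem isClosedElt_powerset_iff {s : Set X} :
    (powersetFunctor.obj (.op X)).IsClosedElt s ↔ IsClosed s := by
  unfold MTAlg.IsClosedElt
  rw [dia_powerset]
  exact closure_eq_iff_isClosed

theorem isClopenElt_powerset_iff {s : Set X} :
    (powersetFunctor.obj (.op X)).IsClopenElt s ↔ IsClopen s :=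
  and_congr isClosedElt_powerset_iff isOpenElt_powerset_iff

theorem isCompactElt_powerset_iff {s : Set X} :
    (powersetFunctor.obj (.op X)).IsCompactElt s ↔ IsCompact s := by
  constructor
  · intro h
    refine isCompact_of_finite_subcover fun {ι} U hU hs => ?_
    obtain ⟨T, hTS, hT, hsT⟩ := h (Set.range U)
      (by
        rintro _ ⟨i, rfl⟩
        exact isOpenElt_powerset_iff.mpr (hU i)) hs
    obtain ⟨t, -, ht, rfl⟩ := Set.exists_subset_image_finite_and.mp
      ⟨T, by rwa [Set.image_univ], hT, rfl⟩
    refine ⟨ht.toFinset, fun x hx => ?_⟩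
    obtain ⟨_, ⟨i, hi, rfl⟩, hxi⟩ := hsT hx
    exact Set.mem_biUnion (ht.mem_toFinset.mpr hi) hxi
  · intro h S hS hle
    obtain ⟨T, hTS, hT, hsT⟩ := h.elim_finite_subcover_image (b := S) (c := id)
      (fun u hu => isOpenElt_powerset_iff.mp (hS u hu)) (hle.trans_eq Set.sUnion_eq_biUnion)
    refine ⟨T, hTS, hT, hsT.trans_eq Set.sUnion_eq_biUnion.symm⟩

theorem isLocallyStoneAlg_powerset (hX : IsLocallyStoneSpace X) :
    (powersetFunctor.obj (.op X)).IsLocallyStoneAlg := by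
  obtain ⟨⟨hT1, hbasis⟩, hlc, hT2⟩ := hX
  refine ⟨⟨fun s => ?_, fun s hs => ?_⟩, fun s hs => ?_, fun s => ?_⟩
  · refine Set.Subset.antisymm (fun x hx => ?_) (Set.sUnion_subset fun c hc => hc.2)
    exact ⟨{x}, ⟨isClosedElt_powerset_iff.mpr isClosed_singleton,
      Set.singleton_subset_iff.mpr hx⟩, rfl⟩
  · refine Set.Subset.antisymm (fun x hx => ?_) (Set.sUnion_subset fun c hc => hc.2)
    obtain ⟨b, hb, hxb, hbs⟩ := hbasis.exists_subset_of_mem_open hx (isOpenElt_powerset_iff.mp hs)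
    exact ⟨b, ⟨isClopenElt_powerset_iff.mpr hb, hbs⟩, hxb⟩
  · refine Set.Subset.antisymm (fun x hx => ?_) (Set.sUnion_subset ?_)
    · obtain ⟨k, hk, hxk, hks⟩ := exists_compact_subset (isOpenElt_powerset_iff.mp hs) hx
      exact ⟨interior k, ⟨isOpenElt_powerset_iff.mpr isOpen_interior, k,
        isCompactElt_powerset_iff.mpr hk, interior_subset, hks⟩, hxk⟩
    · rintro v ⟨-, k, -, hvk, hks⟩
      exact Set.Subset.trans hvk hks
  · refine Set.Subset.antisymm (fun x hx => ?_) (Set.sUnion_subset fun c hc => hc.2)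
    -- Singletons are approximated elements: if `V` is a neighbourhood of `x` disjoint from an open
    -- `U` containing `y`, then the closure of `V` omits `y`.
    refine ⟨{x}, ⟨?_, Set.singleton_subset_iff.mpr hx⟩, rfl⟩
    refine Set.Subset.antisymm (Set.subset_sInter ?_) fun y hy => ?_
    · rintro _ ⟨c, hc, rfl⟩
      exact (Set.Subset.trans hc subset_closure).trans_eq (dia_powerset (interior c)).symm
    · by_contra hxy
      obtain ⟨U, V, hU, hV, hyU, hxV, hUV⟩ := t2_separation (show y ≠ x from hxy)
      have hy' := hy _ ⟨V, ?_, rfl⟩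
      · exact (hUV.closure_right hU).le_bot
          ⟨hyU, closure_mono interior_subset ((dia_powerset (interior V)).le hy')⟩
      · change {x} ⊆ interior V
        rwa [hV.interior_eq, Set.singleton_subset_iff]

theorem isCompactAlg_powerset [CompactSpace X] :
    (powersetFunctor.obj (.op X)).IsCompactAlg :=
  isCompactElt_powerset_iff.mpr isCompact_univ

theorem isSaturatedElt_powerset_iff {s : Set X} :
    (powersetFunctor.obj (.op X)).IsSaturatedElt s ↔ IsSaturatedSet s := by
  refine exists_congr fun S => and_congr (forall₂_congr fun U _ => isOpenElt_powerset_iff) Iff.rfl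

theorem properMT_powerset_map {Y : TopCat.{u}} {f : X ⟶ Y} (hf : properTop f) :
    properMT (powersetFunctor.map f.op) := fun _ ha =>
  ⟨isCompactElt_powerset_iff.mpr
    (hf _ (isCompactElt_powerset_iff.mp ha.1) (isSaturatedElt_powerset_iff.mp ha.2)),
    ha.2.map _⟩

end Powerset

/-! ### Atoms of locally Stone MT-algebras -/

namespace MTAlg

variable {M N : MTAlg.{u}}

theorem IsLocallyStoneAlg.isCompact_eta_iff (hM : M.IsLocallyStoneAlg) {a : M} :
    IsCompact (eta M a) ↔ M.IsCompactElt a := by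
  let e : M ≃o powersetFunctor.obj (.op (TopCat.of (Atoms M))) := hM.etaOrderIso
  have he : ∀ a, e (M.box a) = (powersetFunctor.obj (.op (TopCat.of (Atoms M)))).box (e a) :=
    hM.eta_box
  refine (isCompactElt_powerset_iff (X := TopCat.of (Atoms M))).symm.trans
    ⟨fun h => ?_, fun h => h.map_orderIso he⟩
  rw [← e.symm_apply_apply a]
  exact h.map_orderIso (orderIso_symm_box he)

theorem IsLocallyStoneAlg.isLocallyStoneSpace_atoms (hM : M.IsLocallyStoneAlg) :
    IsLocallyStoneSpace (TopCat.of (Atoms M)) := by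
  have hT1 : T1Space (Atoms M) := ⟨fun x => by
    rw [← eta_val x, ← isOpen_compl_iff, ← eta_compl]
    exact isOpen_eta (isClosedElt_iff.mp (hM.isT1Alg.isClosedElt_of_isAtom x.2))⟩
  have hnhds : ∀ (x : Atoms M) (s : Set (Atoms M)), x ∈ s → IsOpen s →
      ∃ w, M.IsClopenElt w ∧ M.IsCompactElt w ∧ x ∈ eta M w ∧ eta M w ⊆ s := by
    rintro x _ hx ⟨u, hu, rfl⟩
    rw [hM.eq_sSup_compact_clopen hu] at hx
    obtain ⟨w, hw, hxw⟩ := atom_le_sSup x _ hx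
    exact ⟨w, hw.1, hw.2.1, hxw, hM.eta_subset_iff.mpr hw.2.2⟩
  have hbasis : TopologicalSpace.IsTopologicalBasis {s : Set (Atoms M) | IsClopen s} := by
    refine TopologicalSpace.isTopologicalBasis_of_isOpen_of_nhds (fun u hu => hu.isOpen) ?_
    intro x s hx hs
    obtain ⟨w, hw, -, hxw, hws⟩ := hnhds x s hx hs
    exact ⟨_, isClopen_eta hw, hxw, hws⟩
  -- Total separation supplies the Hausdorff property.
  have := totallySeparatedSpace_of_t0_of_basis_clopen hbasis
  refine ⟨⟨hT1, hbasis⟩, ⟨fun x n hn => ?_⟩, inferInstanceAs (T2Space (Atoms M))⟩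
  obtain ⟨s, hsn, hs, hxs⟩ := mem_nhds_iff.mp hn
  obtain ⟨w, hw, hwc, hxw, hws⟩ := hnhds x s hxs hs
  exact ⟨eta M w, (isClopen_eta hw).isOpen.mem_nhds hxw, hws.trans hsn,
    hM.isCompact_eta_iff.mpr hwc⟩

theorem IsLocallyStoneAlg.compactSpace_atoms (hM : M.IsLocallyStoneAlg) (hc : M.IsCompactAlg) :
    CompactSpace (Atoms M) := ⟨by
  have h := hM.isCompact_eta_iff.mpr hc
  rwa [show eta M ⊤ = Set.univ from Set.eq_univ_of_forall fun x => le_top (α := M)] at h⟩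

theorem IsLocallyStoneAlg.properTop_atoms_map (hM : M.IsLocallyStoneAlg)
    (hN : N.IsLocallyStoneAlg) {f : M ⟶ N} (hf : properMT f) :
    properTop (atomsFunctor.map f.op) := by
  intro K hK _
  -- Every set of atoms is some `eta M a`, and by adjunction its preimage is `eta N` of the image of
  -- `a`.
  obtain ⟨a, rfl⟩ := hM.etaOrderIso.surjective K
  have h := hN.isCompact_eta_iff.mpr
    (hf a ⟨hM.isCompact_eta_iff.mp hK, hM.isT1Alg.isSaturatedElt a⟩).1
  have heq : (atomsFunctor.map f.op).hom ⁻¹' eta M a = eta N (MTHom.hom f a) :=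
    Set.ext fun x => leftAdj_le_iff f x.1 a
  exact heq ▸ h

end MTAlg

/-! ### The dual equivalence -/

/-- A space is homeomorphic to the space of atoms of its powerset. -/
noncomputable def atomsPowersetHomeomorph (X : TopCat.{u}) :
    X ≃ₜ Atoms (powersetFunctor.obj (.op X)) where
  toFun x := ⟨({x} : Set X), Set.isAtom_singleton x⟩
  invFun a := (Set.isAtom_iff.mp a.2).choose
  left_inv x := (Set.singleton_eq_singleton_iff.mp
    (Set.isAtom_iff.mp (Set.isAtom_singleton x)).choose_spec).symm
  right_inv a := Subtype.ext (Set.isAtom_iff.mp a.2).choose_spec.symm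
  continuous_toFun := ⟨by
    rintro _ ⟨s, hs, rfl⟩
    let t : Set X := s
    have h : {x : X | {x} ⊆ t} = t := Set.ext fun x => Set.singleton_subset_iff
    change IsOpen {x : X | {x} ⊆ t}
    exact h.symm ▸ isOpenElt_powerset_iff.mp hs⟩
  continuous_invFun := ⟨fun s hs => ⟨s, isOpenElt_powerset_iff.mpr hs, by
    ext a
    have h := (Set.isAtom_iff.mp a.2).choose_spec
    exact (Set.singleton_subset_iff (s := s)).symm.trans (congrArg (· ⊆ s) h.symm).to_iff⟩⟩

theorem properTop_of_homeomorph {X Y : TopCat.{u}} (e : X ≃ₜ Y) :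
    properTop (TopCat.ofHom (e : C(X, Y))) := fun _ hK _ =>
  e.isCompact_preimage.mpr hK

/-- The isomorphism given by a homeomorphism. -/
def isoOfHomeomorph {Q : ObjectProperty TopCat.{u}} {X Y : SubCat Q properTop}
    (e : X.obj ≃ₜ Y.obj) : X ≅ Y where
  hom := ⟨TopCat.ofHom (e : C(X.obj, Y.obj)), properTop_of_homeomorph e⟩
  inv := ⟨TopCat.ofHom (e.symm : C(Y.obj, X.obj)), properTop_of_homeomorph e.symm⟩
  hom_inv_id := SubCat.Hom.ext (TopCat.hom_ext (ContinuousMap.ext e.symm_apply_apply))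
  inv_hom_id := SubCat.Hom.ext (TopCat.hom_ext (ContinuousMap.ext e.apply_symm_apply))

/-- Stated for general `P` and `Q` so as to serve both the locally Stone and the Stone case. -/
theorem atomsPowersetRestrictToDualEquivalence {P : ObjectProperty MTAlg.{u}}
    {Q : ObjectProperty TopCat.{u}} (hP : P ≤ lStoneMT)
    (atObj : ∀ M, P M → Q (atomsFunctor.obj (.op M)))
    (powObj : ∀ X, Q X → P (powersetFunctor.obj (.op X))) :
    AtomsPowersetRestrictToDualEquivalence P Q := by
  have atMap : ∀ ⦃M N : MTAlg.{u}⦄ (f : M ⟶ N), P M → P N → properMT f →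
      properTop (atomsFunctor.map f.op) := fun M N f hM hN hf =>
    (hP M hM).properTop_atoms_map (hP N hN) hf
  have powMap : ∀ ⦃X Y : TopCat.{u}⦄ (f : X ⟶ Y), Q X → Q Y → properTop f →
      properMT (powersetFunctor.map f.op) := fun X Y f _ _ hf => properMT_powerset_map hf
  refine ⟨atObj, atMap, powObj, powMap, ?_⟩
  intro A B
  let η : 𝟭 (SubCat P properMT) ≅ A.rightOp ⋙ B :=
    NatIso.ofComponents
      (fun M => MTAlg.isoOfOrderIso (Y := (A.rightOp ⋙ B).obj M) (hP _ M.property).etaOrderIso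
        (hP _ M.property).eta_box)
      (fun {M N} f => SubCat.Hom.ext (MTAlg.hom_ext fun a => Set.ext fun y =>
        (leftAdj_le_iff f.hom y.1 a).symm))
  let ε : 𝟭 (SubCat Q properTop) ≅ B.rightOp ⋙ A :=
    NatIso.ofComponents
      (fun X => isoOfHomeomorph (Y := (B.rightOp ⋙ A).obj X) (atomsPowersetHomeomorph X.obj))
      (fun {X Y} f => SubCat.Hom.ext (TopCat.hom_ext (ContinuousMap.ext fun x =>
        -- Both sides have the same upper bounds: the left adjoint of preimage sends `{x}` to the
        -- singleton of its image.
        Subtype.ext (eq_of_forall_ge_iff fun s => by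
          refine Iff.trans ?_ (leftAdj_le_iff (powersetFunctor.map f.hom.op) _ s).symm
          exact Set.singleton_subset_iff.trans
            (Set.singleton_subset_iff (s := f.hom.hom ⁻¹' s)).symm))))
  -- `Equivalence.mk` requires no triangle identity, so the two natural isomorphisms suffice.
  let E : SubCat P properMT ≌ (SubCat Q properTop)ᵒᵖ :=
    CategoryTheory.Equivalence.mk A.rightOp B η (NatIso.op ε)
  have hA : A.rightOp.IsEquivalence := E.isEquivalence_functor
  have hB : B.IsEquivalence := E.isEquivalence_inverse
  exact ⟨inferInstanceAs A.rightOp.leftOp.IsEquivalence, hB, ⟨η, fun M a => rfl⟩,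
    ⟨ε, fun X x => rfl⟩⟩

/-! ### The way-below relation -/

section WayBelow

variable {L K : Type u} [Order.Frame L] [Order.Frame K]

theorem WayBelow.le {a b : L} (h : WayBelow a b) : a ≤ b := by
  obtain ⟨T, hT, -, haT⟩ := h {b} (by simp)
  exact haT.trans (sSup_le fun t ht => (hT ht).le)

theorem WayBelow.mono {a b c d : L} (h : WayBelow b c) (hab : a ≤ b) (hcd : c ≤ d) :
    WayBelow a d := fun S hS => by
  obtain ⟨T, hTS, hT, hbT⟩ := h S (hcd.trans hS)
  exact ⟨T, hTS, hT, hab.trans hbT⟩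

theorem WayBelow.map_orderIso {a b : L} (h : WayBelow a b) (e : L ≃o K) :
    WayBelow (e a) (e b) := by
  intro S hS
  obtain ⟨T, hTS, hT, haT⟩ := h (e.symm '' S) (by rwa [← map_sSup, e.le_symm_apply])
  obtain ⟨T, hTS', rfl⟩ := Set.subset_image_iff.mp hTS
  refine ⟨T, hTS', hT.of_finite_image e.symm.injective.injOn, ?_⟩
  rwa [← map_sSup, e.le_symm_apply] at haT

theorem sup_compl_eq_top_iff_isComplemented {c : L} : c ⊔ cᶜ = ⊤ ↔ IsComplemented c :=
  ⟨fun h => ⟨cᶜ, disjoint_compl_right, codisjoint_iff.mpr h⟩,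
    fun ⟨_, hd⟩ => by rw [hd.compl_eq, hd.sup_eq_top]⟩

/-- Frame analogue of `IsCompactElt.of_isClosedElt_le`: with `cᶜ` added, a cover of `c` covers `⊤`,
hence `a`. -/
theorem WayBelow.self_of_complemented {a c : L} (h : WayBelow c a) (hca : c ⊔ cᶜ = ⊤) :
    WayBelow c c := by
  intro S hS
  obtain ⟨T, hTS, hT, hcT⟩ := h (insert cᶜ S) (by
    rw [sSup_insert]
    refine le_top.trans ?_
    rw [← hca, sup_comm]
    exact sup_le_sup_left hS _)
  refine ⟨T \ {cᶜ}, ?_, hT.sdiff, ?_⟩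
  · rintro u ⟨hu, hne⟩
    exact (hTS hu).resolve_left hne
  · refine disjoint_compl_right.left_le_of_le_sup_left (c := cᶜ) ?_
    rw [← sSup_insert]
    exact hcT.trans (sSup_le_sSup (by rw [Set.insert_sdiff_singleton]; simp))

end WayBelow

theorem isCompactFrm_iff {L : Frm.{u}} : IsCompactFrm L ↔ WayBelow (⊤ : L) ⊤ := by
  unfold IsCompactFrm WayBelow
  rw [CompleteLattice.isCompactElement_iff_exists_le_sSup_of_le_sSup]
  refine forall₂_congr fun S _ => ⟨?_, ?_⟩
  · rintro ⟨t, ht, h⟩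
    exact ⟨t, ht, t.finite_toSet, by rwa [← Finset.sup_id_eq_sSup]⟩
  · rintro ⟨T, hTS, hT, h⟩
    exact ⟨hT.toFinset, by simpa using hTS, by simpa [Finset.sup_id_eq_sSup] using h⟩

/-- The isomorphism given by an order isomorphism. -/
def frmIsoOfOrderIso {Q : ObjectProperty Frm.{u}} {K L : SubCat Q properFrm}
    (e : K.obj ≃o L.obj) : K ≅ L where
  hom := ⟨(Frm.Iso.mk e).hom, fun _ _ h => h.map_orderIso e⟩
  inv := ⟨(Frm.Iso.mk e).inv, fun _ _ h => h.map_orderIso e.symm⟩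
  hom_inv_id := SubCat.Hom.ext (Frm.Iso.mk e).hom_inv_id
  inv_hom_id := SubCat.Hom.ext (Frm.Iso.mk e).inv_hom_id

/-- Frame homomorphisms from a zero-dimensional frame to a compact one are proper. -/
theorem properFrm_of_isCompactFrm {K L : Frm.{u}} (h : K ⟶ L) (hK : IsZeroDimFrm K)
    (hL : IsCompactFrm L) : properFrm h := by
  intro a b hab
  -- `sSup T` is a complemented element between `a` and `b`; its image is complemented in a compact
  -- frame, hence way below itself.
  obtain ⟨T, hTS, hT, haT⟩ := hab _ (hK b).le
  have hc : IsComplemented (sSup T) := isComplemented_sSup_of_finite hT fun c hc =>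
    sup_compl_eq_top_iff_isComplemented.mp (hTS hc).1
  obtain ⟨d, hd⟩ := hc
  have hd' : IsComplemented (h.hom (sSup T)) := ⟨h.hom d, hd.map h.hom⟩
  have htop : WayBelow (h.hom (sSup T)) ⊤ := (isCompactFrm_iff.mp hL).mono le_top le_rfl
  exact (htop.self_of_complemented (sup_compl_eq_top_iff_isComplemented.mpr hd')).mono
    (OrderHomClass.mono h.hom haT) (OrderHomClass.mono h.hom (sSup_le fun c hc => (hTS hc).2))

/-! ### Frames of open elements -/

namespace MTAlg

variable {M N : MTAlg.{u}}

theorem wayBelow_of_isCompactElt {u v : M.Opens} {k : M} (hk : M.IsCompactElt k)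
    (huk : u.1 ≤ k) (hkv : k ≤ v.1) : WayBelow u v := by
  intro S hS
  obtain ⟨T, hTS, hT, hkT⟩ := hk (Subtype.val '' S)
    (by
      rintro _ ⟨w, -, rfl⟩
      exact w.2) (hkv.trans hS)
  obtain ⟨T, hTS', rfl⟩ := Set.subset_image_iff.mp hTS
  exact ⟨T, hTS', hT.of_finite_image Subtype.val_injective.injOn, huk.trans hkT⟩

theorem isCompactElt_of_wayBelow_self {u : M.Opens} (h : WayBelow u u) :
    M.IsCompactElt u.1 := by
  intro S hS hle
  obtain ⟨T, hTS, hT, huT⟩ := h (Subtype.val ⁻¹' S) (hle.trans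
    (sSup_le_sSup fun w hw => ⟨⟨w, hS w hw⟩, hw, rfl⟩))
  exact ⟨Subtype.val '' T, Set.image_subset_iff.mpr hTS, hT.image _, huT⟩

theorem isCompactFrm_opens_iff : IsCompactFrm (opensFunctor.obj M) ↔ M.IsCompactAlg :=
  isCompactFrm_iff.trans ⟨fun h => isCompactElt_of_wayBelow_self (M := M) h,
    fun h => wayBelow_of_isCompactElt (M := M) (u := ⊤) (v := ⊤) h le_rfl le_rfl⟩

/-- Converse of `wayBelow_of_isCompactElt`; the two translate properness between algebras and
frames. -/
theorem IsLocallyStoneAlg.exists_of_wayBelow (hM : M.IsLocallyStoneAlg) {u v : M.Opens}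
    (h : WayBelow u v) : ∃ w, M.IsClopenElt w ∧ M.IsCompactElt w ∧ u.1 ≤ w ∧ w ≤ v.1 := by
  obtain ⟨T, hTS, hT, huT⟩ :=
    h {w | M.IsClopenElt w.1 ∧ M.IsCompactElt w.1 ∧ w ≤ v}
      ((hM.eq_sSup_compact_clopen v.2).le.trans
        (sSup_le_sSup fun w hw => ⟨⟨w, hw.1.2⟩, hw, rfl⟩))
  refine ⟨(sSup T).1, isClopenElt_sSup_of_finite (hT.image _) ?_,
    isCompactElt_sSup_of_finite (hT.image _) ?_, huT, sSup_le ?_⟩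
  all_goals rintro _ ⟨w, hw, rfl⟩
  exacts [(hTS hw).1, (hTS hw).2.1, (hTS hw).2.2]

theorem IsLocallyStoneAlg.isLocallyStoneFrm (hM : M.IsLocallyStoneAlg) :
    IsLocallyStoneFrm (opensFunctor.obj M) := by
  constructor
  · intro v
    refine le_antisymm ?_ (sSup_le fun u hu => hu.le)
    refine (hM.eq_sSup_compact_clopen v.2).le.trans
      (sSup_le_sSup fun w hw => ⟨⟨w, hw.1.2⟩, ?_, rfl⟩)
    exact wayBelow_of_isCompactElt hw.2.1 le_rfl hw.2.2
  · intro v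
    refine le_antisymm ?_ (sSup_le fun u hu => hu.2)
    refine (hM.1.2 v.1 v.2).le.trans (sSup_le_sSup fun w hw => ⟨⟨w, hw.1.2⟩, ⟨?_, hw.2⟩, rfl⟩)
    refine sup_compl_eq_top_iff_isComplemented.mpr ⟨⟨wᶜ, hw.1.compl.2⟩, ?_, ?_⟩
    · exact disjoint_iff.mpr (Subtype.ext (inf_compl_self w))
    · exact codisjoint_iff.mpr (Subtype.ext (sup_compl_eq_top (x := w)))

theorem IsLocallyStoneAlg.properFrm_opens_map (hM : M.IsLocallyStoneAlg) {f : M ⟶ N}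
    (hf : properMT f) : properFrm (opensFunctor.map f) := by
  intro u v huv
  obtain ⟨w, -, hw, huw, hwv⟩ := hM.exists_of_wayBelow huv
  exact wayBelow_of_isCompactElt (hf w ⟨hw, hM.isT1Alg.isSaturatedElt w⟩).1
    (OrderHomClass.mono (MTHom.hom f) huw) (OrderHomClass.mono (MTHom.hom f) hwv)

/-- MT-morphisms from a `T₁` MT-algebra are determined by their restrictions to open elements. -/
theorem IsT1Alg.opensFunctor_map_injective (hM : M.IsT1Alg) {f g : M ⟶ N}
    (h : opensFunctor.map f = opensFunctor.map g) : f = g := by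
  have hopen : ∀ u, M.IsOpenElt u → MTHom.hom f u = MTHom.hom g u := fun u hu =>
    congrArg Subtype.val (DFunLike.congr_fun (congrArg Frm.Hom.hom h) (⟨u, hu⟩ : M.Opens))
  refine hom_ext fun a => ?_
  rw [hM a, map_sSup, map_sSup]
  congr 1
  refine Set.image_congr fun c hc => ?_
  have h1 := hopen _ (isClosedElt_iff.mp hc.1)
  rwa [map_compl', map_compl', compl_inj_iff] at h1

/-- Frame homomorphisms between the frames of open elements induce maps between atoms. -/
theorem IsLocallyStoneAlg.exists_atom_of_frameHom (hM : M.IsLocallyStoneAlg)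
    (h : FrameHom M.Opens N.Opens) (y : Atoms N) :
    ∃ x : Atoms M, ∀ u : M.Opens, x.1 ≤ u.1 ↔ y.1 ≤ (h u).1 := by
  -- As `y` is an atom and `h` preserves joins, `m` is the largest open element whose image is not
  -- above `y`. Any atom below `mᶜ` will do as `x`.
  set m : M.Opens := sSup {u | ¬ y.1 ≤ (h u).1} with hm
  have hym : ¬ y.1 ≤ (h m).1 := by
    rw [hm, map_sSup]
    intro hle
    obtain ⟨_, ⟨_, ⟨u, hu, rfl⟩, rfl⟩, hyu⟩ := atom_le_sSup y _ hle
    exact hu hyu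
  have hne : m.1ᶜ ≠ ⊥ := fun hbot => by
    have hmtop : m = ⊤ := Subtype.ext (compl_eq_bot.mp hbot)
    rw [hmtop, map_top] at hym
    exact hym le_top
  obtain ⟨x, hx, hxm⟩ := hM.exists_atom_le hne
  have key : ∀ u : M.Opens, x ≤ u.1 → y.1 ≤ (h u).1 := by
    intro u hxu
    by_contra hyu
    have hum : u ≤ m := le_sSup hyu
    have h1 : x ≤ m.1 := hxu.trans hum
    exact hx.1 (by simpa using le_inf h1 hxm)
  refine ⟨⟨x, hx⟩, fun u => ⟨key u, fun hyu => ?_⟩⟩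
  -- Some clopen `w ≤ u` has `y` below its image. If `x` were not below `u`, then `x ≤ wᶜ`, and
  -- `key` would put `y` below the images of both `w` and `wᶜ`, which are disjoint.
  have hu : u = sSup {w : M.Opens | M.IsClopenElt w.1 ∧ w ≤ u} := by
    refine le_antisymm ?_ (sSup_le fun w hw => hw.2)
    exact (hM.1.2 u.1 u.2).le.trans (sSup_le_sSup fun w hw => ⟨⟨w, hw.1.2⟩, hw, rfl⟩)
  rw [hu, map_sSup] at hyu
  obtain ⟨_, ⟨_, ⟨w, hw, rfl⟩, rfl⟩, hyw⟩ := atom_le_sSup y _ hyu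
  by_contra hxu
  have hxw : x ≤ w.1ᶜ := le_compl_iff_disjoint_right.mpr
    (hx.not_le_iff_disjoint.mp fun hxw => hxu (hxw.trans hw.2))
  let w' : M.Opens := ⟨w.1ᶜ, hw.1.compl.2⟩
  have h1 : y.1 ≤ (h w ⊓ h w').1 := le_inf hyw (key w' hxw)
  rw [← map_inf, show w ⊓ w' = ⊥ from Subtype.ext (inf_compl_self w.1), map_bot] at h1
  exact y.2.1 (le_bot_iff.mp h1)

theorem IsLocallyStoneAlg.exists_hom_of_frameHom (hM : M.IsLocallyStoneAlg)
    (hN : N.IsLocallyStoneAlg) (h : FrameHom M.Opens N.Opens) :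
    ∃ f : M ⟶ N, ∀ u : M.Opens, MTHom.hom f u.1 = (h u).1 := by
  choose φ hφ using hM.exists_atom_of_frameHom h
  -- The preimage map of `φ`, transported along the two `eta` isomorphisms.
  let g : CompleteLatticeHom M N :=
    (CompleteLatticeHom.OrderIso.toCompleteLatticeHom hN.etaOrderIso.symm).comp
      ((CompleteLatticeHom.setPreimage φ).comp
        (CompleteLatticeHom.OrderIso.toCompleteLatticeHom hM.etaOrderIso))
  have hg : ∀ a, eta N (g a) = φ ⁻¹' eta M a := fun a => hN.etaOrderIso.apply_symm_apply _
  have hgu : ∀ u : M.Opens, g u.1 = (h u).1 := by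
    intro u
    refine hN.etaOrderIso.injective ((hg u.1).trans (Set.ext fun y => hφ y u))
  refine ⟨⟨g, fun a => ?_⟩, hgu⟩
  have h1 := hgu ⟨M.box a, M.box_box a⟩
  have h2 : N.IsOpenElt (g (M.box a)) := h1 ▸ (h ⟨M.box a, M.box_box a⟩).2
  rw [← h2]
  exact N.box_mono (OrderHomClass.mono g (M.box_le a))

/-- A compact `k` lies below a compact clopen `w`, and `w ≪ w` makes the image of `w` compact; the
image of `k` is closed below it. -/
theorem IsLocallyStoneAlg.properMT_of_properFrm (hM : M.IsLocallyStoneAlg) {f : M ⟶ N}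
    (hf : properFrm (opensFunctor.map f)) : properMT f := by
  refine fun k hk => ⟨?_, hk.2.map f⟩
  obtain ⟨w, hw, hwc, hkw, -⟩ := hM.exists_compact_clopen_between hk.1 M.box_top le_top
  have h1 : WayBelow (⟨w, hw.2⟩ : M.Opens) ⟨w, hw.2⟩ :=
    wayBelow_of_isCompactElt hwc le_rfl le_rfl
  exact (isCompactElt_of_wayBelow_self (hf _ _ h1)).of_isClosedElt_le
    ((hM.isClosedElt_of_isCompactElt hk.1).map f) (OrderHomClass.mono (MTHom.hom f) hkw)

end MTAlg

/-! ### Points of locally Stone frames -/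

section Points

open Locale

variable {L : Frm.{u}}

theorem IsLocallyStoneFrm.exists_compact_complemented (hL : IsLocallyStoneFrm L) {a b : L}
    (hab : ¬ a ≤ b) : ∃ c : L, c ⊔ cᶜ = ⊤ ∧ WayBelow c c ∧ c ≤ a ∧ ¬ c ≤ b := by
  by_contra! h
  refine hab ?_
  rw [hL.1 a]
  refine sSup_le fun x hx => ?_
  rw [hL.2 x]
  refine sSup_le fun c hc => ?_
  exact h c hc.1 ((hx.mono hc.2 le_rfl).self_of_complemented hc.1) (hc.2.trans hx.le)

/-- Locally Stone frames are spatial. -/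
theorem IsLocallyStoneFrm.exists_point (hL : IsLocallyStoneFrm L) {a b : L} (hab : ¬ a ≤ b) :
    ∃ p : PT L, p a ∧ ¬ p b := by
  obtain ⟨c, -, hc, hca, hcb⟩ := hL.exists_compact_complemented hab
  obtain ⟨m, hbm, hm⟩ := exists_maximal_not_ge (O := Set.univ) (fun _ _ => Set.mem_univ _)
    (fun S _ h => hc S h) (Set.mem_univ b) hcb
  have hcm : ¬ c ≤ m := hm.prop.2
  -- By maximality. With distributivity this makes `m` prime, so `u ↦ ¬ u ≤ m` is a point.
  have hsup : ∀ u, ¬ u ≤ m → c ≤ m ⊔ u := fun u hu => by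
    by_contra hn
    exact hu (le_sup_right.trans (hm.le_of_ge ⟨Set.mem_univ _, hn⟩ le_sup_left))
  refine ⟨⟨⟨⟨fun u => ¬ u ≤ m, fun u v => propext ⟨fun h => ?_, fun h => ?_⟩⟩, ?_⟩, ?_⟩,
    fun h => hcm (hca.trans h), fun h => h hbm⟩
  · exact ⟨fun hu => h (inf_le_left.trans hu), fun hv => h (inf_le_right.trans hv)⟩
  · refine fun huv => hcm ?_
    have h1 := le_inf (hsup u h.1) (hsup v h.2)
    rwa [← sup_inf_left, sup_eq_left.mpr huv] at h1
  · exact eq_true fun h => hcm (le_top.trans h)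
  · intro S
    simp [Prop.exists_iff]

theorem isClopen_setOf_point {c : L} (hc : c ⊔ cᶜ = ⊤) : IsClopen {p : PT L | p c} := by
  refine ⟨⟨⟨cᶜ, Set.ext fun p => ?_⟩⟩, ⟨c, rfl⟩⟩
  have h1 : p c ∨ p cᶜ := by
    have h : p (c ⊔ cᶜ) = (p c ⊔ p cᶜ) := map_sup p c cᶜ
    rw [hc, map_top] at h
    exact h.mp trivial
  have h2 : ¬ (p c ∧ p cᶜ) := fun h => by
    have h' : p (c ⊓ cᶜ) := (map_inf p c cᶜ).mpr h
    rw [inf_compl_self, map_bot] at h'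
    exact h'
  change p cᶜ ↔ ¬ p c
  tauto

theorem IsLocallyStoneFrm.isCompact_setOf_point (hL : IsLocallyStoneFrm L) {c : L}
    (hc : WayBelow c c) : IsCompact {p : PT L | p c} := by
  rw [← isCompactElt_powerset_iff (X := TopCat.of (PT L))]
  intro S hS hle
  obtain ⟨T, hTS, hT, hcT⟩ := hc {u : L | {p : PT L | p u} ∈ S} (by
    -- Spatiality turns the topological cover into a cover in `L`: otherwise some point would
    -- contain `c` but miss the join.
    by_contra hn
    obtain ⟨p, hpc, hp⟩ := hL.exists_point hn
    obtain ⟨s, hs, hps⟩ := hle hpc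
    obtain ⟨u, rfl⟩ := isOpenElt_powerset_iff.mp (hS s hs)
    exact hp (OrderHomClass.mono p (le_sSup (a := u) hs) hps))
  refine ⟨(fun u => {p : PT L | p u}) '' T, Set.image_subset_iff.mpr hTS, hT.image _,
    fun p hp => ?_⟩
  have h : p (sSup T) := OrderHomClass.mono p hcT hp
  rw [map_sSup] at h
  obtain ⟨_, ⟨u, hu, rfl⟩, hpu⟩ := h
  exact ⟨_, ⟨u, hu, rfl⟩, hpu⟩

theorem IsLocallyStoneFrm.isLocallyStoneSpace_points (hL : IsLocallyStoneFrm L) :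
    IsLocallyStoneSpace (TopCat.of (PT L)) := by
  have hnhds : ∀ (p : PT L) (s : Set (PT L)), p ∈ s → IsOpen s →
      ∃ t, IsClopen t ∧ IsCompact t ∧ p ∈ t ∧ t ⊆ s := by
    rintro p _ hp ⟨u, rfl⟩
    have hu : u ≤ sSup {c | c ⊔ cᶜ = ⊤ ∧ WayBelow c c ∧ c ≤ u} := by
      by_contra hn
      obtain ⟨c, hc, hcc, hcu, hcn⟩ := hL.exists_compact_complemented hn
      exact hcn (le_sSup ⟨hc, hcc, hcu⟩)
    have h : p (sSup {c | c ⊔ cᶜ = ⊤ ∧ WayBelow c c ∧ c ≤ u}) := OrderHomClass.mono p hu hp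
    rw [map_sSup] at h
    obtain ⟨_, ⟨c, hc, rfl⟩, hpc⟩ := h
    exact ⟨{p | p c}, isClopen_setOf_point hc.1, hL.isCompact_setOf_point hc.2.1, hpc,
      fun q hq => OrderHomClass.mono q hc.2.2 hq⟩
  have hbasis : TopologicalSpace.IsTopologicalBasis {s : Set (PT L) | IsClopen s} := by
    refine TopologicalSpace.isTopologicalBasis_of_isOpen_of_nhds (fun u hu => hu.isOpen) ?_
    intro p s hp hs
    obtain ⟨t, ht, -, hpt, hts⟩ := hnhds p s hp hs
    exact ⟨t, ht, hpt, hts⟩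
  have hT0 : T0Space (PT L) := ⟨fun p q hpq => DFunLike.ext _ _ fun u =>
    propext (hpq.mem_open_iff (s := {x : PT L | x u}) ⟨u, rfl⟩)⟩
  have := totallySeparatedSpace_of_t0_of_basis_clopen hbasis
  refine ⟨⟨inferInstanceAs (T1Space (PT L)), hbasis⟩, ⟨fun p n hn => ?_⟩,
    inferInstanceAs (T2Space (PT L))⟩
  obtain ⟨s, hsn, hs, hps⟩ := mem_nhds_iff.mp hn
  obtain ⟨t, ht, htc, hpt, hts⟩ := hnhds p s hps hs
  exact ⟨t, ht.isOpen.mem_nhds hpt, hts.trans hsn, htc⟩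

/-- A locally Stone frame is the frame of open sets of its space of points. -/
theorem IsLocallyStoneFrm.nonempty_orderIso (hL : IsLocallyStoneFrm L) :
    Nonempty ((powersetFunctor.obj (.op (TopCat.of (PT L)))).Opens ≃o L) := by
  let f : L → (powersetFunctor.obj (.op (TopCat.of (PT L)))).Opens := fun u =>
    ⟨{p : PT L | p u}, isOpenElt_powerset_iff.mpr ⟨u, rfl⟩⟩
  have hf : ∀ u v, f u ≤ f v ↔ u ≤ v := fun u v =>
    ⟨fun h => by
      by_contra hn
      obtain ⟨p, hu, hv⟩ := hL.exists_point hn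
      exact hv (h hu), fun h p hp => OrderHomClass.mono p h hp⟩
  refine ⟨(RelIso.ofSurjective (OrderEmbedding.ofMapLEIff f hf) ?_).symm⟩
  rintro ⟨s, hs⟩
  obtain ⟨u, rfl⟩ := isOpenElt_powerset_iff.mp hs
  exact ⟨u, rfl⟩

end Points

/-! ### The equivalence with frames -/

/-- In `hess` a bare order isomorphism is enough, since it preserves joins, finite meets and `≪`. -/
theorem opensRestrictsToEquivalence {P : ObjectProperty MTAlg.{u}} {Q : ObjectProperty Frm.{u}}
    (hP : P ≤ lStoneMT) (hobj : ∀ M, P M → Q (opensFunctor.obj M))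
    (hess : ∀ L : Frm.{u}, Q L → ∃ M : MTAlg.{u}, P M ∧ Nonempty (M.Opens ≃o L)) :
    OpensRestrictsToEquivalence P Q := by
  refine ⟨hobj, fun M N f hM hN hf => (hP M hM).properFrm_opens_map hf, ?_, ?_, ?_⟩
  · exact ⟨fun {M N f g} h => SubCat.Hom.ext
      ((hP _ M.property).isT1Alg.opensFunctor_map_injective (congrArg SubCat.Hom.hom h))⟩
  · refine ⟨fun {M N} h => ?_⟩
    obtain ⟨f, hf⟩ := (hP _ M.property).exists_hom_of_frameHom (hP _ N.property) h.hom.hom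
    have hmap : opensFunctor.map f = h.hom := Frm.ext fun u => Subtype.ext (hf u)
    exact ⟨⟨f, (hP _ M.property).properMT_of_properFrm (hmap ▸ h.property)⟩,
      SubCat.Hom.ext hmap⟩
  · refine ⟨fun L => ?_⟩
    obtain ⟨M, hM, ⟨e⟩⟩ := hess L.obj L.property
    exact ⟨⟨M, hM⟩, ⟨frmIsoOfOrderIso e⟩⟩

end MTStone

open MTStone
theorem mainTheorem11 :
    -- locally Stone MT-algebras, locally Stone frames and locally Stone spaces
    OpensRestrictsToEquivalence.{u} lStoneMT lStoneFrm ∧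
    AtomsPowersetRestrictToDualEquivalence.{u} lStoneMT lStone ∧
    -- Stone MT-algebras, Stone frames and Stone spaces
    OpensRestrictsToEquivalence.{u} stoneMT stoneFrm ∧
    AtomsPowersetRestrictToDualEquivalence.{u} stoneMT stone ∧
    -- between Stone objects every morphism is proper
    (∀ (M N : MTAlg.{u}) (f : M ⟶ N), stoneMT M → stoneMT N → properMT f) ∧
    (∀ (K L : Frm.{u}) (h : K ⟶ L), stoneFrm K → stoneFrm L → properFrm h) ∧
    (∀ (X Y : TopCat.{u}) (g : X ⟶ Y), stone X → stone Y → properTop g) := by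
  refine ⟨?_, ?_, ?_, ?_, ?_, ?_, ?_⟩
  · exact opensRestrictsToEquivalence le_rfl (fun M hM => hM.isLocallyStoneFrm) fun L hL =>
      ⟨_, isLocallyStoneAlg_powerset hL.isLocallyStoneSpace_points, hL.nonempty_orderIso⟩
  · exact atomsPowersetRestrictToDualEquivalence le_rfl
      (fun M hM => hM.isLocallyStoneSpace_atoms) fun X hX => isLocallyStoneAlg_powerset hX
  · refine opensRestrictsToEquivalence (fun M hM => hM.1)
      (fun M hM => ⟨hM.1.isLocallyStoneFrm, MTAlg.isCompactFrm_opens_iff.mpr hM.2⟩) fun L hL => ?_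
    obtain ⟨e⟩ := IsLocallyStoneFrm.nonempty_orderIso hL.1
    refine ⟨_, ⟨isLocallyStoneAlg_powerset
      (IsLocallyStoneFrm.isLocallyStoneSpace_points hL.1), ?_⟩, ⟨e⟩⟩
    rw [← MTAlg.isCompactFrm_opens_iff, isCompactFrm_iff]
    have h := (isCompactFrm_iff.mp hL.2).map_orderIso e.symm
    rwa [map_top] at h
  · refine atomsPowersetRestrictToDualEquivalence (fun M hM => hM.1)
      (fun M hM => ⟨hM.1.isLocallyStoneSpace_atoms, hM.1.compactSpace_atoms hM.2⟩)
      fun X hX => ⟨isLocallyStoneAlg_powerset hX.1, ?_⟩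
    have := hX.2
    exact isCompactAlg_powerset
  · exact fun M N f hM hN => MTAlg.properMT_of_isCompactAlg f hM.1 hN.2
  · exact fun K L h hK hL => properFrm_of_isCompactFrm h hK.1.2 hL.2
  · intro X Y g hX hY K hK _
    have := hX.2
    have := hY.1.2.2
    exact (hK.isClosed.preimage g.hom.continuous).isCompact
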